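/- Let $e\geq 2$ be an integer. A partition $\lambda=(\lambda_1\geq\lambda_2\geq\cdots)$ is identified with its Young diagram $\{(r,c)\in\mathbb{N}^2 : c\leq\lambda_r\}$, whose elements are its nodes; $\lambda'$ is the conjugate partition. The hook at a node $(r,c)$ of $\lambda$ has arm length $\lambda_r-c$, leg length $\lambda'_c-r$, and length equal to the sum of these two plus $1$. For positive integers $E>Y$, the $(E,Y)$-ladders are the sets $\{(r+k(Y-E),\,c+kY) : k\in\mathbb{Z}\}$ with $(r,c)\in\mathbb{Z}^2$. Two partitions are $(E,Y)$-equivalent if they have equally many nodes in each $(E,Y)$-ladder. A partition is $(E,Y)$-singular if for some integer $t\geq1$ it has a hook of length $Et$ and arm length $Yt-1$, and $(E,Y)$-regular otherwise. The $(E,Y)$-regularisation of $\lambda$ is the (unique) $(E,Y)$-regular partition that is $(E,Y)$-equivalent to $\lambda$. For rational $y\in[1,e-1]$ with denominator $z$ in lowest terms, "$(e,y)$-singular" and "$(e,y)$-regularisation" mean "$(ez,yz)$-singular" and "$(ez,yz)$-regularisation". Write $\lambda^{\mathrm{reg}}$ for the $(e,1)$-regularisation of $\lambda$ (James's $e$-regularisation).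 For partitions, $\mu$ dominates $\lambda$ if $|\mu|=|\lambda|$ and $\mu_1+\dots+\mu_r\geq\lambda_1+\dots+\lambda_r$ for all $r$, and $\mu$ strictly dominates $\lambda$ if moreover $\mu\neq\lambda$. **Lemma.** Let $y$ be a rational number with $1<y\leq e-1$, let $\lambda$ be an $(e,y)$-singular partition, and let $\mu$ be its $(e,y)$-regularisation. Then $\mu^{\mathrm{reg}}$ strictly dominates $\lambda^{\mathrm{reg}}$. -/

import Mathlib

namespace LadderReg

/-- Arm length of the hook of `μ` at the node `(r, c)` (rows and columns are counted from `0`).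
Used only for nodes of `μ`. -/
def armLength (μ : YoungDiagram) (r c : ℕ) : ℕ := μ.rowLen r - c - 1

/-- Leg length of the hook of `μ` at the node `(r, c)`. Used only for nodes of `μ`. -/
def legLength (μ : YoungDiagram) (r c : ℕ) : ℕ := μ.colLen c - r - 1

/-- Number of nodes in the hook of `μ` at the node `(r, c)`. Used only for nodes of `μ`. -/
def hookLength (μ : YoungDiagram) (r c : ℕ) : ℕ := armLength μ r c + legLength μ r c + 1

/-- A partition is `(e, y)`-singular if for some `t ≥ 1` it has a hook with length `e * t` and
arm length `y * t - 1`. -/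
def IsSingular (e y : ℕ) (μ : YoungDiagram) : Prop :=
  ∃ t : ℕ, 1 ≤ t ∧ ∃ r c : ℕ, (r, c) ∈ μ ∧
    hookLength μ r c = e * t ∧ armLength μ r c + 1 = y * t

/-- A partition is `(e, y)`-regular if it is not `(e, y)`-singular. -/
def IsRegular (e y : ℕ) (μ : YoungDiagram) : Prop := ¬ IsSingular e y μ

/-- The `(e, y)`-ladder through `(r, c)`. -/
def ladder (e y : ℕ) (r c : ℤ) : Set (ℤ × ℤ) :=
  {p | ∃ k : ℤ, p = (r + k * ((y : ℤ) - (e : ℤ)), c + k * (y : ℤ))}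

/-- The Young diagram of `μ` as a set of points of `ℤ × ℤ`. -/
def nodes (μ : YoungDiagram) : Set (ℤ × ℤ) :=
  {p | ∃ x ∈ μ.cells, p = ((x.1 : ℤ), (x.2 : ℤ))}

/-- Two partitions are `(e, y)`-equivalent if they have equally many nodes in each
`(e, y)`-ladder. -/
def LadderEquiv (e y : ℕ) (μ ν : YoungDiagram) : Prop :=
  ∀ r c : ℤ, (ladder e y r c ∩ nodes μ).ncard = (ladder e y r c ∩ nodes ν).ncard

/-- `μ` is the `(e, y)`-regularisation of `ν`: it is an `(e, y)`-regular partition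
in the `(e, y)`-ladder class of `ν`. -/
def IsRegularisation (e y : ℕ) (ν μ : YoungDiagram) : Prop :=
  LadderEquiv e y ν μ ∧ IsRegular e y μ

/-- For rational `y`, with denominator `z`, "`(e, y)`-singular" means `(e z, y z)`-singular. -/
def IsSingularRat (e : ℕ) (y : ℚ) (μ : YoungDiagram) : Prop :=
  IsSingular (e * y.den) y.num.toNat μ

/-- For rational `y`, with denominator `z`, the `(e, y)`-regularisation is the
`(e z, y z)`-regularisation. -/
def IsRegularisationRat (e : ℕ) (y : ℚ) (ν μ : YoungDiagram) : Prop :=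
  IsRegularisation (e * y.den) y.num.toNat ν μ

/-- The dominance order on partitions: `μ` dominates `ν`. -/
def Dominates (μ ν : YoungDiagram) : Prop :=
  μ.card = ν.card ∧
    ∀ r : ℕ, ∑ i ∈ Finset.range r, ν.rowLen i ≤ ∑ i ∈ Finset.range r, μ.rowLen i

/-- `μ` strictly dominates `ν`. -/
def StrictlyDominates (μ ν : YoungDiagram) : Prop := Dominates μ ν ∧ μ ≠ ν

section James

/-- The number of columns `j` such that the node in column `j` of the `(d + 1, 1)`-ladder
`{(i, j) | i + d * j = s}` is missing from `μ`. -/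
def missing (d : ℕ) (μ : YoungDiagram) (s : ℕ) : Finset ℕ :=
  (Finset.range (s + 1)).filter fun j => d * j ≤ s ∧ (s - d * j, j) ∉ μ.cells

theorem mem_missing {d : ℕ} (hd : 1 ≤ d) {μ : YoungDiagram} {s j : ℕ} :
    j ∈ missing d μ s ↔ d * j ≤ s ∧ (s - d * j, j) ∉ μ := by
  simp only [missing, Finset.mem_filter, Finset.mem_range, YoungDiagram.mem_cells]
  constructor
  · exact fun h => h.2
  · intro h
    have : 1 * j ≤ d * j := Nat.mul_le_mul_right j hd
    exact ⟨by omega, h⟩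

theorem missing_mono {d : ℕ} (hd : 1 ≤ d) (μ : YoungDiagram) {s t : ℕ} (h : s ≤ t) :
    missing d μ s ⊆ missing d μ t := by
  intro j hj
  rw [mem_missing hd] at hj ⊢
  exact ⟨hj.1.trans h, fun hm => hj.2 (μ.up_left_mem (by omega) le_rfl hm)⟩

theorem card_missing_lt {d : ℕ} (hd : 1 ≤ d) (μ : YoungDiagram) (s : ℕ)
    (h : (missing d μ s).Nonempty) :
    (missing d μ s).card < (missing d μ (s + d)).card := by
  have hmax := Finset.max'_mem _ h
  set m := (missing d μ s).max' h with hm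
  have hnot : m + 1 ∉ missing d μ s := fun hc => by
    have := Finset.le_max' _ _ hc
    omega
  have hsub : insert (m + 1) (missing d μ s) ⊆ missing d μ (s + d) := by
    intro j hj
    rcases Finset.mem_insert.1 hj with rfl | hj
    · rw [mem_missing hd] at hmax ⊢
      have e1 : d * (m + 1) = d * m + d := by ring
      refine ⟨by omega, fun hc => hmax.2 (μ.up_left_mem ?_ (Nat.le_succ m) hc)⟩
      omega
    · exact missing_mono hd μ (Nat.le_add_right s d) hj
  have := Finset.card_le_card hsub
  rw [Finset.card_insert_of_notMem hnot] at this
  omega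

/-- A bound for the ladders that meet `μ`. -/
theorem exists_bound (d : ℕ) (μ : YoungDiagram) :
    ∃ N : ℕ, ∀ x ∈ μ.cells, x.1 + d * x.2 < N :=
  ⟨(μ.cells.sup fun x => x.1 + d * x.2) + 1, fun _ hx =>
    Nat.lt_succ_of_le (Finset.le_sup (f := fun x : ℕ × ℕ => x.1 + d * x.2) hx)⟩

/-- All columns that the ladder `{(i, j) | i + d * j = s}` meets. -/
def columns (d s : ℕ) : Finset ℕ := Finset.range (s / d + 1)

theorem mem_columns {d : ℕ} (hd : 1 ≤ d) {s j : ℕ} : j ∈ columns d s ↔ d * j ≤ s := by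
  rw [columns, Finset.mem_range, Nat.lt_succ_iff, Nat.le_div_iff_mul_le hd, mul_comm]

theorem missing_subset {d : ℕ} (hd : 1 ≤ d) (μ : YoungDiagram) (s : ℕ) :
    missing d μ s ⊆ columns d s := fun _ hj =>
  (mem_columns hd).2 ((mem_missing hd).1 hj).1

/-- The nodes of `μ` moved to the highest positions in their `(d + 1, 1)`-ladders. -/
theorem exists_moved {d : ℕ} (hd : 1 ≤ d) (μ : YoungDiagram) :
    ∃ ν : YoungDiagram, ∀ i j : ℕ, (i, j) ∈ ν ↔ (missing d μ (i + d * j)).card ≤ j := by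
  obtain ⟨N, hN⟩ := exists_bound d μ
  have key : ∀ i j : ℕ, (missing d μ (i + d * j)).card ≤ j → i + d * j < N := by
    intro i j h
    by_contra hc
    have hsub : columns d (i + d * j) ⊆ missing d μ (i + d * j) := by
      intro k hk
      rw [mem_columns hd] at hk
      rw [mem_missing hd]
      refine ⟨hk, fun hm => hc ?_⟩
      have := hN _ hm
      simp only at this
      omega
    have h2 := Finset.card_le_card hsub
    rw [columns, Finset.card_range, Nat.add_mul_div_left _ _ hd] at h2
    generalize i / d = q at h2
    omega
  have left : ∀ i j : ℕ, (missing d μ (i + d * (j + 1))).card ≤ j + 1 →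
      (missing d μ (i + d * j)).card ≤ j := by
    intro i j h
    rcases Finset.eq_empty_or_nonempty (missing d μ (i + d * j)) with h0 | h0
    · simp [h0]
    · have := card_missing_lt hd μ _ h0
      rw [show i + d * j + d = i + d * (j + 1) by ring] at this
      omega
  refine ⟨⟨((Finset.range N) ×ˢ (Finset.range N)).filter
    fun x => (missing d μ (x.1 + d * x.2)).card ≤ x.2, ?_⟩, ?_⟩
  · rintro ⟨i, j⟩ ⟨i', j'⟩ ⟨hi, hj⟩ hx
    simp only [Finset.coe_filter, Finset.mem_product, Finset.mem_range, Set.mem_ofPred_eq] at hx ⊢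
    simp only at hi hj
    refine ⟨⟨by omega, by omega⟩, ?_⟩
    have h1 : (missing d μ (i' + d * j)).card ≤ j :=
      (Finset.card_le_card (missing_mono hd μ (by omega))).trans hx.2
    clear hx
    induction j, hj using Nat.le_induction with
    | base => exact h1
    | succ n _ ih => exact ih (left _ _ h1)
  · intro i j
    rw [← YoungDiagram.mem_cells]
    simp only [Finset.mem_filter, Finset.mem_product, Finset.mem_range]
    constructor
    · exact fun h => h.2
    · intro h
      have := key i j h
      have h3 : 1 * j ≤ d * j := Nat.mul_le_mul_right j hd
      exact ⟨⟨by omega, by omega⟩, h⟩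

theorem ladder_inter_nodes {d : ℕ} (hd : 1 ≤ d) (μ : YoungDiagram) (r c : ℤ) :
    (ladder (d + 1) 1 r c ∩ nodes μ).ncard =
      if 0 ≤ r + d * c then
        (columns d (r + d * c).toNat \ missing d μ (r + d * c).toNat).card else 0 := by
  split_ifs with h
  · obtain ⟨s, hs⟩ := Int.eq_ofNat_of_zero_le h
    rw [hs, Int.toNat_natCast, ← Set.ncard_coe_finset]
    symm
    refine Set.ncard_congr (fun j _ => (((s - d * j : ℕ) : ℤ), (j : ℤ))) ?_ ?_ ?_
    · intro j hj
      rw [Finset.mem_coe, Finset.mem_sdiff, mem_columns hd, mem_missing hd] at hj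
      refine ⟨⟨(j : ℤ) - c, ?_⟩, ⟨(s - d * j, j), ?_, rfl⟩⟩
      · rw [Prod.mk.injEq]
        push_cast [hj.1]
        constructor <;> linarith
      · by_contra hc
        exact hj.2 ⟨hj.1, hc⟩
    · intro a b _ _ hab
      simpa using (Prod.mk.inj hab).2
    · rintro p ⟨⟨k, hk⟩, ⟨⟨i, j⟩, hx, hp⟩⟩
      simp only at hp
      rw [hp, Prod.mk.injEq] at hk
      have hij : i + d * j = s := by
        zify
        rw [← hs, hk.1, hk.2]
        push_cast
        ring
      refine ⟨j, ?_, ?_⟩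
      · rw [Finset.mem_coe, Finset.mem_sdiff, mem_columns hd, mem_missing hd]
        refine ⟨by omega, fun hc => hc.2 ?_⟩
        rw [show s - d * j = i by omega]
        exact hx
      · rw [hp, show s - d * j = i by omega]
  · convert Set.ncard_empty (ℤ × ℤ)
    rw [Set.eq_empty_iff_forall_notMem]
    rintro p ⟨⟨k, hk⟩, ⟨⟨i, j⟩, hx, hp⟩⟩
    simp only at hp
    rw [hp, Prod.mk.injEq] at hk
    apply h
    have hij : (i : ℤ) + d * j = r + d * c := by
      rw [hk.1, hk.2]
      push_cast
      ring
    rw [← hij]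
    positivity

theorem exists_isRegularisation_one {e : ℕ} (he : 2 ≤ e) (μ : YoungDiagram) :
    ∃ ν : YoungDiagram, IsRegularisation e 1 μ ν := by
  obtain ⟨d, rfl⟩ : ∃ d, e = d + 1 := ⟨e - 1, by omega⟩
  have hd : 1 ≤ d := by omega
  obtain ⟨ν, hν⟩ := exists_moved hd μ
  refine ⟨ν, ?_, ?_⟩
  · intro r c
    rw [ladder_inter_nodes hd, ladder_inter_nodes hd]
    split_ifs with h
    · generalize (r + d * c).toNat = s
      have hmiss : missing d ν s = Finset.range (missing d μ s).card := by
        ext j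
        rw [mem_missing hd, hν, Finset.mem_range, not_le]
        constructor
        · rintro ⟨h1, h2⟩
          rwa [Nat.sub_add_cancel h1] at h2
        · intro h2
          have h1 : d * j ≤ s := by
            by_contra h1
            have h3 : missing d μ s ⊆ Finset.range j := by
              intro k hk
              rw [mem_missing hd] at hk
              rw [Finset.mem_range]
              by_contra hjk
              exact h1 ((Nat.mul_le_mul_left d (not_lt.1 hjk)).trans hk.1)
            have := Finset.card_le_card h3
            rw [Finset.card_range] at this
            omega
          exact ⟨h1, by rwa [Nat.sub_add_cancel h1]⟩
      rw [Finset.card_sdiff_of_subset (missing_subset hd μ s),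
        Finset.card_sdiff_of_subset (missing_subset hd ν s), hmiss, Finset.card_range]
    · rfl
  · rintro ⟨t, ht, r, c, hrc, hlen, harm⟩
    have h1 : c < ν.rowLen r := YoungDiagram.mem_iff_lt_rowLen.1 hrc
    have h2 : r < ν.colLen c := YoungDiagram.mem_iff_lt_colLen.1 hrc
    have e1 : (d + 1) * t = d * t + t := by ring
    rw [hookLength, legLength] at hlen
    rw [armLength] at harm hlen
    have h3 : (r, c + t) ∉ ν := by
      rw [YoungDiagram.mem_iff_lt_rowLen]
      omega
    have h4 : (r + d * t, c) ∈ ν := by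
      rw [YoungDiagram.mem_iff_lt_colLen]
      omega
    rw [hν] at h3 h4
    rw [show r + d * t + d * c = r + d * (c + t) by ring] at h4
    omega

/-- James's `e`-regularisation, that is, the `(e, 1)`-regularisation, of a partition. -/
noncomputable def jamesReg (e : ℕ) (he : 2 ≤ e) (μ : YoungDiagram) : YoungDiagram :=
  (exists_isRegularisation_one he μ).choose

theorem jamesReg_spec (e : ℕ) (he : 2 ≤ e) (μ : YoungDiagram) :
    IsRegularisation e 1 μ (jamesReg e he μ) :=
  (exists_isRegularisation_one he μ).choose_spec

end James

end LadderReg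

/-! ### Nodes as integer points, and hooks cut out by two ends in a ladder. -/

namespace LadderReg

/-! Write `e = d + 1`, `E = e * z`, and give the point `(i, j)` the level `i + d * j`, so that the
`(e, 1)`-ladders are the level sets. One step up an `(E, Y)`-ladder, to `(i - (E - Y), j + Y)`,
raises the level by `d * Y - (E - Y) = e * (Y - z)`, which is positive exactly because `y > 1`. An
`(E, Y)`-regular partition has its nodes as high in their `(E, Y)`-ladders as any equivalent
partition can (`lower_le_of_isRegular`). Hence passing from `lam` to `mu` pushes nodes to later
levels: for every `S`, `mu` has at most as many nodes of level at most `S` as `lam`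
(`countUpTo_le_of_isRegular`). James regularisation preserves these counts, and for an `e`-regular
partition smaller counts mean greater dominance (`dominates_of_countUpTo_le`). If the two James
regularisations coincided, all the counts would agree, which forces `lam = mu`
(`eq_of_countUpTo_eq`); but one is singular and the other regular. -/

/-- The nodes of `μ` as a finite set of points of `ℤ × ℤ`. -/
def nodeFinset (μ : YoungDiagram) : Finset (ℤ × ℤ) :=
  μ.cells.image fun x => ((x.1 : ℤ), (x.2 : ℤ))

theorem coe_nodeFinset (μ : YoungDiagram) : (nodeFinset μ : Set (ℤ × ℤ)) = nodes μ := by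
  ext p
  simp only [nodeFinset, Finset.coe_image, Set.mem_image, Finset.mem_coe, nodes]
  exact ⟨fun ⟨x, hx, h⟩ => ⟨x, hx, h.symm⟩, fun ⟨x, hx, h⟩ => ⟨x, hx, h.symm⟩⟩

theorem cast_mem_nodeFinset {μ : YoungDiagram} {a b : ℕ} :
    ((a : ℤ), (b : ℤ)) ∈ nodeFinset μ ↔ (a, b) ∈ μ := by
  simp [nodeFinset]

theorem nonneg_of_mem {μ : YoungDiagram} {x : ℤ × ℤ} (h : x ∈ nodeFinset μ) :
    0 ≤ x.1 ∧ 0 ≤ x.2 := by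
  simp only [nodeFinset, Finset.mem_image] at h
  obtain ⟨y, -, rfl⟩ := h
  simp

theorem mem_of_le {μ : YoungDiagram} {a b a' b' : ℤ} (h : (a, b) ∈ nodeFinset μ)
    (ha : 0 ≤ a') (hb : 0 ≤ b') (haa : a' ≤ a) (hbb : b' ≤ b) : (a', b') ∈ nodeFinset μ := by
  lift a' to ℕ using ha
  lift b' to ℕ using hb
  lift a to ℕ using by omega
  lift b to ℕ using by omega
  rw [cast_mem_nodeFinset] at h ⊢
  exact μ.up_left_mem (by omega) (by omega) h

theorem nodeFinset_injective : Function.Injective nodeFinset := by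
  intro μ ν h
  refine SetLike.ext fun x => ?_
  rw [← cast_mem_nodeFinset (μ := μ), h, cast_mem_nodeFinset]

theorem card_nodeFinset (μ : YoungDiagram) : (nodeFinset μ).card = μ.card :=
  Finset.card_image_of_injective _ fun a b h => by
    simpa [Prod.ext_iff] using h

/-- A column end and a row end of `μ` that lie in the same ladder, the row end being higher,
give a hook that makes `μ` singular. -/
theorem isSingular_of_ends {E Y : ℕ} (hYE : Y < E) {μ : YoungDiagram} {i j : ℤ} {t : ℕ}
    (ht : 1 ≤ t) (h1 : (i, j) ∈ nodeFinset μ) (h2 : (i + 1, j) ∉ nodeFinset μ)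
    (h3 : (i - t * ((E : ℤ) - Y), j + t * Y - 1) ∈ nodeFinset μ)
    (h4 : (i - t * ((E : ℤ) - Y), j + t * Y) ∉ nodeFinset μ) : IsSingular E Y μ := by
  obtain ⟨p, rfl⟩ := Nat.exists_eq_add_of_lt hYE
  obtain ⟨hi, hj⟩ := nonneg_of_mem h1
  obtain ⟨hr, hc⟩ := nonneg_of_mem h3
  simp only at hi hj hr hc
  obtain ⟨r, hr'⟩ := Int.eq_ofNat_of_zero_le hr
  lift i to ℕ using hi
  lift j to ℕ using hj
  have hi : i = r + t * (p + 1) := by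
    zify; push_cast at hr'; linarith
  rw [hr'] at h3 h4
  have e4 : (j : ℤ) + t * Y = ((j + t * Y : ℕ) : ℤ) := by push_cast; rfl
  have hpos : 1 ≤ j + t * Y := by zify; linarith
  have e3 : (j : ℤ) + t * Y - 1 = ((j + t * Y - 1 : ℕ) : ℤ) := by
    push_cast [hpos]; rfl
  have e2 : (i : ℤ) + 1 = ((i + 1 : ℕ) : ℤ) := by push_cast; rfl
  rw [e3, cast_mem_nodeFinset, YoungDiagram.mem_iff_lt_rowLen] at h3
  rw [e4, cast_mem_nodeFinset, YoungDiagram.mem_iff_lt_rowLen] at h4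
  rw [e2, cast_mem_nodeFinset, YoungDiagram.mem_iff_lt_colLen] at h2
  rw [cast_mem_nodeFinset] at h1
  have h5 : (r, j) ∈ μ := μ.up_left_mem (by rw [hi]; exact Nat.le_add_right _ _) le_rfl h1
  have h6 := YoungDiagram.mem_iff_lt_rowLen.1 h5
  rw [YoungDiagram.mem_iff_lt_colLen] at h1
  have e5 : t * (p + 1) = t * p + t := by ring
  have e6 : (Y + p + 1) * t = t * Y + t * p + t := by ring
  have e7 : Y * t = t * Y := mul_comm _ _
  -- The hook at `(r, j)` runs from the column end to the row end: leg `t * (E - Y)`, arm `t * Y -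
  -- 1`, hence length `E * t`.
  refine ⟨t, ht, r, j, h5, ?_, ?_⟩
  · rw [hookLength, armLength, legLength]
    omega
  · rw [armLength]
    omega

/-! ### Regular partitions sit highest in their `(E, Y)`-ladders. -/

section Lower

/-- The number of nodes of `μ` weakly below `x` in its `(E, Y)`-ladder. -/
noncomputable def lower (E Y : ℕ) (μ : YoungDiagram) (x : ℤ × ℤ) : ℕ :=
  open Classical in
  ((nodeFinset μ).filter fun z => ∃ k : ℕ, z = (x.1 + k * ((E : ℤ) - Y), x.2 - k * Y)).card

/-- The number of nodes of `μ` strictly above `x` in its `(E, Y)`-ladder. -/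
noncomputable def upper (E Y : ℕ) (μ : YoungDiagram) (x : ℤ × ℤ) : ℕ :=
  open Classical in
  ((nodeFinset μ).filter fun z =>
    ∃ k : ℕ, z = (x.1 - (k + 1) * ((E : ℤ) - Y), x.2 + (k + 1) * Y)).card

variable {E Y : ℕ} {lam mu : YoungDiagram}

theorem lower_add_upper (hYE : Y < E) (mu : YoungDiagram) (x : ℤ × ℤ) :
    lower E Y mu x + upper E Y mu x = (ladder E Y x.1 x.2 ∩ nodes mu).ncard := by
  classical
  rw [lower, upper, ← Finset.card_union_of_disjoint, ← coe_nodeFinset, ← Set.ncard_coe_finset]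
  · congr 1
    ext z
    simp only [Finset.coe_union, Finset.coe_filter, Set.mem_union, Set.mem_ofPred_eq, ladder,
      Set.mem_inter_iff, Finset.mem_coe]
    constructor
    · rintro (⟨hz, k, rfl⟩ | ⟨hz, k, rfl⟩)
      · exact ⟨⟨-k, by ext <;> simp <;> ring⟩, hz⟩
      · exact ⟨⟨k + 1, by ext <;> simp; ring⟩, hz⟩
    · rintro ⟨⟨k, rfl⟩, hz⟩
      rcases le_or_gt k 0 with hk | hk
      · obtain ⟨n, hn⟩ := Int.eq_ofNat_of_zero_le (neg_nonneg.2 hk)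
        obtain rfl : k = -n := by omega
        exact Or.inl ⟨hz, n, by ext <;> simp <;> ring⟩
      · obtain ⟨n, hn⟩ := Int.eq_ofNat_of_zero_le (show 0 ≤ k - 1 by omega)
        obtain rfl : k = n + 1 := by omega
        exact Or.inr ⟨hz, n, by ext <;> simp; ring⟩
  · rw [Finset.disjoint_filter]
    rintro z - ⟨k, rfl⟩ ⟨n, hn⟩
    have h1 := (Prod.mk.inj hn).1
    have h2 : (0 : ℤ) < (E : ℤ) - Y := by omega
    have h3 : ((k : ℤ) + n + 1) * ((E : ℤ) - Y) = 0 := by linarith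
    have h4 : 0 < ((k : ℤ) + n + 1) * ((E : ℤ) - Y) := by positivity
    omega

theorem lower_eq_zero {x : ℤ × ℤ}
    (h : ∀ k : ℕ, (x.1 + k * ((E : ℤ) - Y), x.2 - k * Y) ∉ nodeFinset mu) :
    lower E Y mu x = 0 := by
  classical
  rw [lower, Finset.card_eq_zero, Finset.filter_eq_empty_iff]
  rintro z hz ⟨k, rfl⟩
  exact h k hz

theorem upper_eq_zero {x : ℤ × ℤ}
    (h : ∀ k : ℕ, (x.1 - (k + 1) * ((E : ℤ) - Y), x.2 + (k + 1) * Y) ∉ nodeFinset mu) :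
    upper E Y mu x = 0 := by
  classical
  rw [upper, Finset.card_eq_zero, Finset.filter_eq_empty_iff]
  rintro z hz ⟨k, rfl⟩
  exact h k hz

/-- Translation by `y - x` injects the first set of nodes into the second. -/
theorem lower_le_lower {x y : ℤ × ℤ}
    (h : ∀ k : ℕ, (x.1 + k * ((E : ℤ) - Y), x.2 - k * Y) ∈ nodeFinset mu →
      (y.1 + k * ((E : ℤ) - Y), y.2 - k * Y) ∈ nodeFinset mu) :
    lower E Y mu x ≤ lower E Y mu y := by
  classical
  refine Finset.card_le_card_of_injOn (fun z => z + (y - x)) ?_ (by simp [Set.InjOn])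
  intro z hz
  rw [Finset.mem_coe, Finset.mem_filter] at hz ⊢
  obtain ⟨hz, k, rfl⟩ := hz
  have e : (x.1 + k * ((E : ℤ) - Y), x.2 - k * Y) + (y - x)
      = (y.1 + k * ((E : ℤ) - Y), y.2 - k * Y) := by
    ext <;> simp; ring
  simp only [e]
  exact ⟨h k hz, k, rfl⟩

theorem upper_le_upper {x y : ℤ × ℤ}
    (h : ∀ k : ℕ, (x.1 - (k + 1) * ((E : ℤ) - Y), x.2 + (k + 1) * Y) ∈ nodeFinset mu →
      (y.1 - (k + 1) * ((E : ℤ) - Y), y.2 + (k + 1) * Y) ∈ nodeFinset mu) :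
    upper E Y mu x ≤ upper E Y mu y := by
  classical
  refine Finset.card_le_card_of_injOn (fun z => z + (y - x)) ?_ (by simp [Set.InjOn])
  intro z hz
  rw [Finset.mem_coe, Finset.mem_filter] at hz ⊢
  obtain ⟨hz, k, rfl⟩ := hz
  have e : (x.1 - (k + 1) * ((E : ℤ) - Y), x.2 + (k + 1) * Y) + (y - x)
      = (y.1 - (k + 1) * ((E : ℤ) - Y), y.2 + (k + 1) * Y) := by
    ext <;> simp; ring
  simp only [e]
  exact ⟨h k hz, k, rfl⟩

theorem lower_down_le (hYE : Y < E) (mu : YoungDiagram) {i j : ℤ} (hi : 0 ≤ i) :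
    lower E Y mu (i + 1, j) ≤ lower E Y mu (i, j) := by
  refine lower_le_lower fun k hk => ?_
  have h1 := nonneg_of_mem hk
  have h2 : (0 : ℤ) < (E : ℤ) - Y := by omega
  have h3 : 0 ≤ (k : ℤ) * ((E : ℤ) - Y) := by positivity
  simp only at hk h1 ⊢
  exact mem_of_le hk (by omega) h1.2 (by omega) le_rfl

theorem upper_le_left (hY : 0 < Y) (mu : YoungDiagram) {i j : ℤ} (hj : 0 ≤ j) :
    upper E Y mu (i, j) ≤ upper E Y mu (i, j - 1) := by
  refine upper_le_upper fun k hk => ?_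
  have h1 := nonneg_of_mem hk
  have h3 : 0 < ((k : ℤ) + 1) * Y := by positivity
  simp only at hk h1 ⊢
  exact mem_of_le hk h1.1 (by omega) le_rfl (by omega)

/-- In a regular partition, the ladder points weakly below a point contain no column end or those
above it contain no row end. -/
theorem IsRegular.lower_or_upper (hYE : Y < E) (h : IsRegular E Y mu) (i j : ℤ) :
    lower E Y mu (i, j) ≤ lower E Y mu (i + 1, j) ∨
      upper E Y mu (i, j - 1) ≤ upper E Y mu (i, j) := by
  by_contra! hc
  obtain ⟨k, hk1, hk2⟩ : ∃ k : ℕ, (i + k * ((E : ℤ) - Y), j - k * Y) ∈ nodeFinset mu ∧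
      (i + 1 + k * ((E : ℤ) - Y), j - k * Y) ∉ nodeFinset mu := by
    by_contra! hn
    exact absurd (lower_le_lower (x := (i, j)) (y := (i + 1, j)) hn) (not_le.2 hc.1)
  obtain ⟨l, hl1, hl2⟩ : ∃ l : ℕ,
      (i - (l + 1) * ((E : ℤ) - Y), j - 1 + (l + 1) * Y) ∈ nodeFinset mu ∧
      (i - (l + 1) * ((E : ℤ) - Y), j + (l + 1) * Y) ∉ nodeFinset mu := by
    by_contra! hn
    exact absurd (upper_le_upper (x := (i, j - 1)) (y := (i, j)) hn) (not_le.2 hc.2)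
  -- The column end is `k` steps below and the row end `l + 1` steps above, since `upper` counts
  -- strictly above; so `t ≥ 1`.
  refine h (isSingular_of_ends hYE (t := k + l + 1) (by omega) hk1 ?_ ?_ ?_)
  · convert hk2 using 3; ring
  · convert hl1 using 2 <;> push_cast <;> ring
  · convert hl2 using 3 <;> push_cast <;> ring

/-- The nodes of a regular partition lie at least as high in their ladders as those of any
equivalent partition. -/
theorem lower_le_of_isRegular (hY : 0 < Y) (hYE : Y < E) (hmu : IsRegular E Y mu)
    (heq : LadderEquiv E Y lam mu) (x : ℤ × ℤ) : lower E Y mu x ≤ lower E Y lam x := by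
  obtain ⟨i, j⟩ := x
  have total : ∀ i j, lower E Y lam (i, j) + upper E Y lam (i, j) =
      lower E Y mu (i, j) + upper E Y mu (i, j) := fun i j => by
    rw [lower_add_upper hYE, lower_add_upper hYE]
    exact heq i j
  have hp : (0 : ℤ) < (E : ℤ) - Y := by omega
  rcases lt_or_ge i 0 with hi | hi
  -- In negative rows nothing lies above, so both `lower` counts are the full ladder count. This
  -- case is separate because `lower_down_le` needs `0 ≤ i`.
  · have hz : ∀ nu, upper E Y nu (i, j) = 0 := fun nu => by
      refine upper_eq_zero fun k hk => ?_
      have h1 := (nonneg_of_mem hk).1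
      have h3 : 0 ≤ ((k : ℤ) + 1) * ((E : ℤ) - Y) := by positivity
      simp only at h1
      omega
    have := total i j
    rw [hz, hz] at this
    omega
  obtain ⟨N, hN⟩ : ∃ N : ℕ, ∀ x ∈ nodeFinset mu, x.1 < N := by
    obtain ⟨N, hN⟩ := (nodeFinset mu).exists_le.imp fun M h => h
    refine ⟨(N.1 + 1).toNat, fun x hx => ?_⟩
    have := (hN x hx).1
    omega
  -- The measure drops on moving down to `(i + 1, j)` or left to `(i, j - 1)`, the two moves offered
  -- by `lower_or_upper`; it is nonpositive only where `lower` of `mu` vanishes.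
  suffices H : ∀ n : ℕ, ∀ i j : ℤ, 0 ≤ i → N - i + (j + 1) ≤ n →
      lower E Y mu (i, j) ≤ lower E Y lam (i, j) from
    H _ i j hi (Int.self_le_toNat _)
  have far : ∀ i j : ℤ, N ≤ i ∨ j < 0 → lower E Y mu (i, j) = 0 := by
    intro i j h
    refine lower_eq_zero fun k hk => ?_
    have h1 := (nonneg_of_mem hk).2
    have h2 := hN _ hk
    have h3 : 0 ≤ (k : ℤ) * ((E : ℤ) - Y) := by positivity
    have h4 : 0 ≤ (k : ℤ) * Y := by positivity
    simp only at h1 h2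
    omega
  intro n
  induction n with
  | zero =>
    intro i j hi hn
    rw [far i j (by push_cast at hn; omega)]
    exact Nat.zero_le _
  | succ n ih =>
    intro i j hi hn
    rcases lt_or_ge j 0 with hj | hj
    · rw [far i j (Or.inr hj)]
      exact Nat.zero_le _
    push_cast at hn
    rcases hmu.lower_or_upper hYE i j with h | h
    · exact h.trans ((ih (i + 1) j (by omega) (by omega)).trans (lower_down_le hYE lam hi))
    -- Complementing the inductive bound in its ladder, the values of `upper` satisfy `lam (i, j) ≤
    -- lam (i, j - 1) ≤ mu (i, j - 1) ≤ mu (i, j)`; complementing again gives the claim.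
    · have h1 := ih i (j - 1) hi (by omega)
      have h2 := upper_le_left (E := E) (i := i) hY lam hj
      have h3 := total i j
      have h4 := total i (j - 1)
      omega

theorem lower_eq_add (hYE : Y < E) (mu : YoungDiagram) (i j : ℤ) :
    lower E Y mu (i, j) = lower E Y mu (i + ((E : ℤ) - Y), j - Y) +
      if (i, j) ∈ nodeFinset mu then 1 else 0 := by
  classical
  have hp : (0 : ℤ) < (E : ℤ) - Y := by omega
  have hnot : (i, j) ∉ (nodeFinset mu).filter fun z => ∃ k : ℕ,
      z = (i + ((E : ℤ) - Y) + k * ((E : ℤ) - Y), j - Y - k * Y) := by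
    rw [Finset.mem_filter]
    rintro ⟨-, k, hk⟩
    have h1 := (Prod.mk.inj hk).1
    have h3 : 0 ≤ (k : ℤ) * ((E : ℤ) - Y) := by positivity
    omega
  have key : ∀ z : ℤ × ℤ, (∃ k : ℕ, z = (i + k * ((E : ℤ) - Y), j - k * Y)) ↔
      z = (i, j) ∨ ∃ k : ℕ, z = (i + ((E : ℤ) - Y) + k * ((E : ℤ) - Y), j - Y - k * Y) := by
    intro z
    constructor
    · rintro ⟨_ | k, rfl⟩
      · left; simp
      · right; exact ⟨k, by ext <;> simp <;> ring⟩
    · rintro (rfl | ⟨k, rfl⟩)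
      · exact ⟨0, by simp⟩
      · exact ⟨k + 1, by ext <;> simp <;> ring⟩
  rw [lower, lower]
  split_ifs with h
  · rw [← Finset.card_insert_of_notMem hnot]
    congr 1
    ext z
    simp only [Finset.mem_filter, Finset.mem_insert, key]
    constructor
    · tauto
    · rintro (rfl | h') <;> tauto
  · rw [add_zero]
    congr 1
    ext z
    simp only [Finset.mem_filter, key]
    constructor
    · rintro ⟨h1, rfl | h2⟩ <;> tauto
    · tauto

/-- Membership of a node is the difference of `lower` at two consecutive ladder points. -/
theorem eq_of_lower_eq (hYE : Y < E) (h : ∀ x, lower E Y lam x = lower E Y mu x) : lam = mu := by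
  refine nodeFinset_injective (Finset.ext fun ⟨i, j⟩ => ?_)
  have h1 := lower_eq_add hYE lam i j
  have h2 := lower_eq_add hYE mu i j
  rw [h, h, h2] at h1
  split_ifs at h1 <;> simp_all

end Lower

/-! ### Counting nodes by level through `(E, Y)`-ladders. -/

section Levels

/-- The number of nodes of `μ` in the first `(d + 1, 1)`-ladders, up to the one numbered `S`. -/
def countUpTo (d : ℕ) (μ : YoungDiagram) (S : ℤ) : ℕ :=
  ((nodeFinset μ).filter fun z => z.1 + d * z.2 ≤ S).card

variable {d E Y : ℕ} {lam mu : YoungDiagram}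

theorem countUpTo_eq_card {S : ℤ} (h : ∀ z ∈ nodeFinset mu, z.1 + d * z.2 ≤ S) :
    countUpTo d mu S = mu.card := by
  rw [countUpTo, Finset.filter_true_of_mem h, card_nodeFinset]

theorem exists_level_bound (d : ℕ) (lam mu : YoungDiagram) :
    ∃ S : ℤ, (∀ z ∈ nodeFinset lam, z.1 + d * z.2 ≤ S) ∧
      ∀ z ∈ nodeFinset mu, z.1 + d * z.2 ≤ S := by
  obtain ⟨S, hS⟩ := ((nodeFinset lam ∪ nodeFinset mu).image fun z : ℤ × ℤ => z.1 + (d : ℤ) * z.2).exists_le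
  exact ⟨S, fun z hz => hS _ (Finset.mem_image_of_mem _ (Finset.mem_union_left _ hz)),
    fun z hz => hS _ (Finset.mem_image_of_mem _ (Finset.mem_union_right _ hz))⟩

/-- The highest point of the `(E, Y)`-ladder of `z` that is at level at most `S`. -/
def topPoint (d E Y : ℕ) (S : ℤ) (z : ℤ × ℤ) : ℤ × ℤ :=
  let k := (S - (z.1 + d * z.2)) / (d * Y - ((E : ℤ) - Y))
  (z.1 - k * ((E : ℤ) - Y), z.2 + k * Y)

theorem topPoint_level (hd : (E : ℤ) - Y < d * Y) (S : ℤ) (z : ℤ × ℤ) :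
    (topPoint d E Y S z).1 + d * (topPoint d E Y S z).2 ≤ S ∧
      S < (topPoint d E Y S z).1 + d * (topPoint d E Y S z).2 + (d * Y - ((E : ℤ) - Y)) := by
  have hδ : (0 : ℤ) < d * Y - ((E : ℤ) - Y) := by omega
  have h1 := Int.emod_nonneg (S - (z.1 + d * z.2)) hδ.ne'
  have h2 := Int.emod_lt_of_pos (S - (z.1 + d * z.2)) hδ
  have h3 := Int.mul_ediv_add_emod (S - (z.1 + d * z.2)) (d * Y - ((E : ℤ) - Y))
  simp only [topPoint]
  constructor <;> nlinarith

theorem topPoint_eq (hd : (E : ℤ) - Y < d * Y) {S : ℤ} {x : ℤ × ℤ} (hx : x.1 + d * x.2 ≤ S)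
    (hx' : S < x.1 + d * x.2 + (d * Y - ((E : ℤ) - Y))) (k : ℤ) :
    topPoint d E Y S (x.1 + k * ((E : ℤ) - Y), x.2 - k * Y) = x := by
  have hδ : (0 : ℤ) < d * Y - ((E : ℤ) - Y) := by omega
  have : (S - (x.1 + k * ((E : ℤ) - Y) + d * (x.2 - k * Y))) / (d * Y - ((E : ℤ) - Y)) = k := by
    rw [Int.ediv_eq_iff_of_pos hδ]
    constructor <;> nlinarith
  simp only [topPoint, this]
  ext <;> simp

/-- Level increases up each `(E, Y)`-ladder, so its nodes of level at most `S` are those weakly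
below its top point. The window of width `d * Y - (E - Y)` contains one point of each ladder. -/
theorem countUpTo_eq_sum_lower (hd : (E : ℤ) - Y < d * Y) (mu : YoungDiagram) {S : ℤ}
    {I : Finset (ℤ × ℤ)} (hI : ∀ z ∈ nodeFinset mu, z.1 + d * z.2 ≤ S → topPoint d E Y S z ∈ I)
    (hle : ∀ x ∈ I, x.1 + d * x.2 ≤ S)
    (hlt : ∀ x ∈ I, S < x.1 + d * x.2 + (d * Y - ((E : ℤ) - Y))) :
    countUpTo d mu S = ∑ x ∈ I, lower E Y mu x := by
  classical
  have hδ : (0 : ℤ) < d * Y - ((E : ℤ) - Y) := by omega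
  rw [countUpTo, Finset.card_eq_sum_card_fiberwise (f := topPoint d E Y S) (t := I)]
  · refine Finset.sum_congr rfl fun x hx => ?_
    rw [lower]
    congr 1
    ext z
    simp only [Finset.mem_filter]
    constructor
    · rintro ⟨⟨hz, hS⟩, rfl⟩
      obtain ⟨k, hk⟩ := Int.eq_ofNat_of_zero_le
        (Int.ediv_nonneg (sub_nonneg.2 hS) hδ.le)
      refine ⟨hz, k, ?_⟩
      simp only [topPoint, hk]
      ext <;> simp
    · rintro ⟨hz, k, rfl⟩
      refine ⟨⟨hz, ?_⟩, topPoint_eq hd (hle x hx) (hlt x hx) k⟩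
      have h1 := hle x hx
      have h2 : 0 ≤ (k : ℤ) * (d * Y - ((E : ℤ) - Y)) := by positivity
      simp only
      linarith
  · intro z hz
    rw [Finset.mem_coe, Finset.mem_filter] at hz
    exact hI z hz.1 hz.2

/-- A common index set for the `(E, Y)`-ladders of two partitions, containing a given point. -/
theorem exists_tops (hd : (E : ℤ) - Y < d * Y) (lam mu : YoungDiagram) (x : ℤ × ℤ) {S : ℤ}
    (hx : x.1 + d * x.2 ≤ S) (hx' : S < x.1 + d * x.2 + (d * Y - ((E : ℤ) - Y))) :
    ∃ I : Finset (ℤ × ℤ), x ∈ I ∧ (∀ x ∈ I, x.1 + d * x.2 ≤ S) ∧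
      (∀ x ∈ I, S < x.1 + d * x.2 + (d * Y - ((E : ℤ) - Y))) ∧
      countUpTo d lam S = ∑ x ∈ I, lower E Y lam x ∧
      countUpTo d mu S = ∑ x ∈ I, lower E Y mu x := by
  let I := insert x ((nodeFinset lam ∪ nodeFinset mu).image (topPoint d E Y S))
  have h1 : ∀ x ∈ I, x.1 + d * x.2 ≤ S := by
    intro z hz
    rcases Finset.mem_insert.1 hz with rfl | hz
    · exact hx
    · obtain ⟨w, -, rfl⟩ := Finset.mem_image.1 hz
      exact (topPoint_level hd S w).1
  have h2 : ∀ x ∈ I, S < x.1 + d * x.2 + (d * Y - ((E : ℤ) - Y)) := by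
    intro z hz
    rcases Finset.mem_insert.1 hz with rfl | hz
    · exact hx'
    · obtain ⟨w, -, rfl⟩ := Finset.mem_image.1 hz
      exact (topPoint_level hd S w).2
  refine ⟨I, Finset.mem_insert_self _ _, h1, h2, ?_, ?_⟩
  · exact countUpTo_eq_sum_lower hd lam (fun z hz _ => Finset.mem_insert_of_mem
      (Finset.mem_image_of_mem _ (Finset.mem_union_left _ hz))) h1 h2
  · exact countUpTo_eq_sum_lower hd mu (fun z hz _ => Finset.mem_insert_of_mem
      (Finset.mem_image_of_mem _ (Finset.mem_union_right _ hz))) h1 h2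

theorem countUpTo_le_of_isRegular (hY : 0 < Y) (hYE : Y < E) (hd : (E : ℤ) - Y < d * Y)
    (hmu : IsRegular E Y mu) (heq : LadderEquiv E Y lam mu) (S : ℤ) :
    countUpTo d mu S ≤ countUpTo d lam S := by
  -- The point `(S, 0)` is a dummy of level `S`; only the index set matters.
  obtain ⟨I, -, -, -, h1, h2⟩ := exists_tops hd lam mu (S, 0) (S := S) (by simp)
    (by simp only; linarith)
  rw [h1, h2]
  exact Finset.sum_le_sum fun x _ => lower_le_of_isRegular hY hYE hmu heq x

theorem eq_of_countUpTo_eq (hY : 0 < Y) (hYE : Y < E) (hd : (E : ℤ) - Y < d * Y)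
    (hmu : IsRegular E Y mu) (heq : LadderEquiv E Y lam mu)
    (h : ∀ S, countUpTo d lam S = countUpTo d mu S) : lam = mu := by
  refine eq_of_lower_eq hYE fun x => ?_
  -- With `S` the level of `x`, `x` itself indexes a summand; equal sums of termwise comparable
  -- terms have equal terms.
  obtain ⟨I, hx, -, -, h1, h2⟩ := exists_tops hd lam mu x le_rfl (by linarith)
  have h3 := h (x.1 + d * x.2)
  rw [h1, h2] at h3
  exact ((Finset.sum_eq_sum_iff_of_le fun x _ =>
    lower_le_of_isRegular hY hYE hmu heq x).1 h3.symm x hx).symm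

/-- Once `S` bounds all levels, nothing lies above the top points, so `lower` there is the full
ladder count. -/
theorem LadderEquiv.card_eq (hYE : Y < E) (hd : (E : ℤ) - Y < d * Y)
    (heq : LadderEquiv E Y lam mu) : lam.card = mu.card := by
  obtain ⟨S, hlam, hmu⟩ := exists_level_bound d lam mu
  obtain ⟨I, -, -, hI, h1, h2⟩ := exists_tops hd lam mu (S, 0) (S := S) (by simp)
    (by simp only; linarith)
  have hup : ∀ nu, (∀ z ∈ nodeFinset nu, z.1 + d * z.2 ≤ S) → ∀ x ∈ I, upper E Y nu x = 0 := by
    intro nu hnu x hx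
    refine upper_eq_zero fun k hk => ?_
    have h3 := hnu _ hk
    have h4 := hI x hx
    have h5 : 0 ≤ (k : ℤ) * (d * Y - ((E : ℤ) - Y)) :=
      mul_nonneg (by positivity) (by linarith)
    simp only at h3
    linarith
  rw [← countUpTo_eq_card hlam, ← countUpTo_eq_card hmu, h1, h2]
  refine Finset.sum_congr rfl fun x hx => ?_
  have h3 := lower_add_upper hYE lam x
  have h4 := lower_add_upper hYE mu x
  rw [hup lam hlam x hx] at h3
  rw [hup mu hmu x hx] at h4
  have := heq x.1 x.2
  omega

end Levels

/-! ### Level counts and dominance for `e`-regular partitions. -/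

section JamesDominance

variable {d : ℕ} {lam mu alpha beta : YoungDiagram}

theorem LadderEquiv.countUpTo_eq (h : LadderEquiv (d + 1) 1 lam mu) (S : ℤ) :
    countUpTo d lam S = countUpTo d mu S := by
  have hlev : ∀ (nu : YoungDiagram) (s : ℤ),
      ((nodeFinset nu).filter fun z => z.1 + (d : ℤ) * z.2 = s).card =
        (ladder (d + 1) 1 s 0 ∩ nodes nu).ncard := by
    intro nu s
    rw [← coe_nodeFinset, ← Set.ncard_coe_finset]
    congr 1
    ext ⟨i, j⟩
    simp only [Finset.coe_filter, Set.mem_ofPred_eq, Set.mem_inter_iff, Finset.mem_coe, ladder,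
      Prod.mk.injEq]
    rw [and_comm]
    refine and_congr_left fun _ => ⟨fun hs => ⟨j, ?_, ?_⟩, ?_⟩
    · push_cast; linarith
    · simp
    · rintro ⟨k, rfl, rfl⟩
      push_cast; ring
  have hsum : ∀ nu : YoungDiagram, countUpTo d nu S =
      ∑ s ∈ Finset.Icc (0 : ℤ) S, ((nodeFinset nu).filter fun z => z.1 + (d : ℤ) * z.2 = s).card := by
    intro nu
    rw [countUpTo, Finset.card_eq_sum_card_fiberwise (f := fun z : ℤ × ℤ => z.1 + (d : ℤ) * z.2)
      (t := Finset.Icc (0 : ℤ) S)]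
    · refine Finset.sum_congr rfl fun s hs => ?_
      rw [Finset.filter_filter]
      congr 1
      refine Finset.filter_congr fun z _ => ?_
      rw [Finset.mem_Icc] at hs
      constructor
      · exact fun h => h.2
      · exact fun h => ⟨by omega, h⟩
    · intro z hz
      rw [Finset.mem_coe, Finset.mem_filter] at hz
      obtain ⟨h1, h2⟩ := nonneg_of_mem hz.1
      rw [Finset.mem_coe, Finset.mem_Icc]
      exact ⟨by positivity, hz.2⟩
  rw [hsum, hsum]
  refine Finset.sum_congr rfl fun s _ => ?_
  rw [hlev, hlev]
  exact h s 0

/-- The nodes of an `e`-regular partition are at the highest positions in their ladders. -/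
theorem IsRegular.mem_of_mem (h : IsRegular (d + 1) 1 mu) {i j : ℕ} (hij : (i + d, j) ∈ mu) :
    (i, j + 1) ∈ mu := by
  by_contra hc
  have h1 := YoungDiagram.mem_iff_lt_colLen.1 hij
  have hmem : (mu.colLen j - 1, j) ∈ mu := YoungDiagram.mem_iff_lt_colLen.2 (by omega)
  refine h ⟨1, le_rfl, mu.colLen j - 1 - d, j, mu.up_left_mem (by omega) le_rfl hmem, ?_⟩
  have h2 : mu.rowLen (mu.colLen j - 1 - d) = j + 1 := by
    have h3 : (mu.colLen j - 1 - d, j) ∈ mu := mu.up_left_mem (by omega) le_rfl hmem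
    have h4 : (mu.colLen j - 1 - d, j + 1) ∉ mu := fun h4 =>
      hc (mu.up_left_mem (by omega) le_rfl h4)
    rw [YoungDiagram.mem_iff_lt_rowLen] at h3 h4
    omega
  rw [hookLength, legLength, armLength, h2]
  omega

theorem IsRegular.mem_of_level_le (h : IsRegular (d + 1) 1 mu) {i j i' j' : ℕ}
    (hij : (i, j) ∈ mu) (hi : i' ≤ i) (hL : i' + d * j' ≤ i + d * j) : (i', j') ∈ mu := by
  rcases le_or_gt j' j with hj | hj
  · exact mu.up_left_mem hi hj hij
  obtain ⟨n, rfl⟩ := Nat.exists_eq_add_of_le hj.le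
  clear hj
  induction n generalizing i j with
  | zero => exact mu.up_left_mem hi (by omega) hij
  | succ n ih =>
    have e : d * (j + (n + 1)) = d * j + d * n + d := by ring
    obtain ⟨k, rfl⟩ : ∃ k, i = k + d := ⟨i - d, by omega⟩
    have e' : d * (j + 1) = d * j + d := by ring
    have e'' : d * (j + 1 + n) = d * j + d * n + d := by ring
    -- Slide one step up the `(d + 1, 1)`-ladder: same level, one column closer to `j'`.
    have := ih (h.mem_of_mem hij) (by omega) (by omega)
    rwa [show j + (n + 1) = j + 1 + n by omega]

theorem sum_rowLen (mu : YoungDiagram) (r : ℕ) :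
    ∑ i ∈ Finset.range r, mu.rowLen i = ((nodeFinset mu).filter fun z => z.1 < (r : ℤ)).card := by
  have h1 : ((nodeFinset mu).filter fun z => z.1 < (r : ℤ)).card =
      (mu.cells.filter fun z => z.1 < r).card := by
    rw [nodeFinset, Finset.filter_image, Finset.card_image_of_injective _ fun a b h => by
      simpa [Prod.ext_iff] using h]
    simp
  rw [h1, Finset.card_eq_sum_card_fiberwise (f := Prod.fst) (t := Finset.range r)
    (fun z hz => by simpa using (Finset.mem_filter.1 hz).2)]
  refine Finset.sum_congr rfl fun i hi => ?_
  rw [YoungDiagram.rowLen_eq_card, YoungDiagram.row, Finset.filter_filter]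
  congr 1
  refine Finset.filter_congr fun z _ => ?_
  rw [Finset.mem_range] at hi
  constructor
  · exact fun h => ⟨by omega, h⟩
  · exact fun h => h.2

theorem card_filter_split (mu : YoungDiagram) (r : ℕ) (S : ℤ) :
    ((nodeFinset mu).filter fun z => z.1 < (r : ℤ) ∧ z.1 + d * z.2 ≤ S).card +
      ((nodeFinset mu).filter fun z => ¬ z.1 < (r : ℤ) ∧ z.1 + d * z.2 ≤ S).card =
      countUpTo d mu S := by
  rw [countUpTo, ← Finset.card_filter_add_card_filter_not
    (s := (nodeFinset mu).filter fun z => z.1 + d * z.2 ≤ S) (fun z : ℤ × ℤ => z.1 < (r : ℤ)),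
    Finset.filter_filter, Finset.filter_filter]
  simp only [and_comm]

/-- Among partitions of the same size, an `e`-regular one with fewer nodes in the first ladders is
more dominant. -/
theorem dominates_of_countUpTo_le (hcard : beta.card = alpha.card)
    (hbeta : IsRegular (d + 1) 1 beta) (h : ∀ S, countUpTo d beta S ≤ countUpTo d alpha S) :
    Dominates beta alpha := by
  refine ⟨hcard, fun r => ?_⟩
  rw [sum_rowLen, sum_rowLen]
  have ha := Finset.card_filter_add_card_filter_not (s := nodeFinset alpha)
    (fun z : ℤ × ℤ => z.1 < (r : ℤ))
  have hb := Finset.card_filter_add_card_filter_not (s := nodeFinset beta)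
    (fun z : ℤ × ℤ => z.1 < (r : ℤ))
  rw [card_nodeFinset] at ha hb
  rcases Finset.eq_empty_or_nonempty ((nodeFinset beta).filter fun z => ¬ z.1 < (r : ℤ)) with h0 | h0
  · rw [h0, Finset.card_empty] at hb
    omega
  -- Take `S` to be the largest level of a node of `beta` outside the first `r` rows. By regularity
  -- `beta` then fills all positions of level at most `S` in those rows, so `alpha` has no more
  -- there; comparing counts up to `S`, `alpha` has at least as many nodes as `beta` in the
  -- remaining rows.
  obtain ⟨w, hw, hmax⟩ := Finset.exists_max_image _ (fun z : ℤ × ℤ => z.1 + d * z.2) h0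
  set S := w.1 + d * w.2
  have hsplit_a := card_filter_split (d := d) alpha r S
  have hsplit_b := card_filter_split (d := d) beta r S
  have hS := h S
  have h1 : ((nodeFinset alpha).filter fun z => z.1 < (r : ℤ) ∧ z.1 + d * z.2 ≤ S).card ≤
      ((nodeFinset beta).filter fun z => z.1 < (r : ℤ) ∧ z.1 + d * z.2 ≤ S).card := by
    refine Finset.card_le_card fun z hz => ?_
    rw [Finset.mem_filter] at hz hw ⊢
    refine ⟨?_, hz.2⟩
    obtain ⟨i, j⟩ := z
    obtain ⟨a, b⟩ := w
    obtain ⟨hz, hzr, hzS⟩ := hz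
    obtain ⟨hw, hwr⟩ := hw
    have hz' := nonneg_of_mem hz
    have hw' := nonneg_of_mem hw
    simp only [S] at hz' hw' hzr hwr hzS
    lift i to ℕ using hz'.1
    lift j to ℕ using hz'.2
    lift a to ℕ using hw'.1
    lift b to ℕ using hw'.2
    rw [cast_mem_nodeFinset] at hw ⊢
    exact hbeta.mem_of_level_le hw (by omega) (by exact_mod_cast hzS)
  have h2 : ((nodeFinset beta).filter fun z => ¬ z.1 < (r : ℤ)).card ≤
      ((nodeFinset beta).filter fun z => ¬ z.1 < (r : ℤ) ∧ z.1 + d * z.2 ≤ S).card := by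
    refine Finset.card_le_card fun z hz => ?_
    have h3 := hmax z hz
    rw [Finset.mem_filter] at hz ⊢
    exact ⟨hz.1, hz.2, h3⟩
  have h3 : ((nodeFinset alpha).filter fun z => ¬ z.1 < (r : ℤ) ∧ z.1 + d * z.2 ≤ S).card ≤
      ((nodeFinset alpha).filter fun z => ¬ z.1 < (r : ℤ)).card :=
    Finset.card_le_card (Finset.monotone_filter_right _ fun _ _ h => h.1)
  omega

theorem card_eq_of_countUpTo_eq (h : ∀ S, countUpTo d lam S = countUpTo d mu S) :
    lam.card = mu.card := by
  obtain ⟨S, h1, h2⟩ := exists_level_bound d lam mu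
  rw [← countUpTo_eq_card h1, ← countUpTo_eq_card h2, h S]

end JamesDominance

end LadderReg

/-! ### The lemma itself, after clearing the denominator of `y`. -/

open LadderReg in
theorem lemma4p4 (e : ℕ) (he : 2 ≤ e) (y : ℚ) (hy1 : 1 < y) (hye : y ≤ (e : ℚ) - 1)
    (lam mu : YoungDiagram) (hlam : LadderReg.IsSingularRat e y lam)
    (hmu : LadderReg.IsRegularisationRat e y lam mu) :
    LadderReg.StrictlyDominates (LadderReg.jamesReg e he mu) (LadderReg.jamesReg e he lam) := by
  obtain ⟨heq, hreg⟩ := hmu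
  obtain ⟨hl, -⟩ := jamesReg_spec e he lam
  obtain ⟨hm, hmr⟩ := jamesReg_spec e he mu
  have hden : (0 : ℚ) < y.den := by exact_mod_cast y.den_pos
  have hynum : y * y.den = y.num := Rat.mul_den_eq_num y
  have hnum : (y.den : ℤ) < y.num := by
    have : (y.den : ℚ) < y.num := by nlinarith
    exact_mod_cast this
  have hnum' : y.num < e * y.den := by
    have : (y.num : ℚ) < e * y.den := by nlinarith
    exact_mod_cast this
  have hYnum : (y.num.toNat : ℤ) = y.num := Int.toNat_of_nonneg (by omega)
  change IsSingular (e * y.den) y.num.toNat lam at hlam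
  generalize y.num.toNat = Y at *
  generalize y.den = z at *
  rw [← hYnum] at hnum hnum'
  obtain ⟨d, rfl⟩ : ∃ d, e = d + 1 := ⟨e - 1, by omega⟩
  have hY : 0 < Y := by omega
  have hYE : Y < (d + 1) * z := by exact_mod_cast hnum'
  -- This is `e * z < e * Y`, that is `y > 1`: steps up an `(E, Y)`-ladder raise the level.
  have hd : (((d + 1) * z : ℕ) : ℤ) - Y < d * Y := by
    push_cast
    nlinarith
  refine ⟨dominates_of_countUpTo_le (d := d) ?_ hmr fun S => ?_, fun hc => ?_⟩
  · rw [← card_eq_of_countUpTo_eq hm.countUpTo_eq, ← card_eq_of_countUpTo_eq hl.countUpTo_eq,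
      heq.card_eq hYE hd]
  · rw [← hm.countUpTo_eq, ← hl.countUpTo_eq]
    exact countUpTo_le_of_isRegular hY hYE hd hreg heq S
  · have : lam = mu := eq_of_countUpTo_eq hY hYE hd hreg heq fun S => by
      rw [hl.countUpTo_eq, hm.countUpTo_eq, hc]
    exact hreg (this ▸ hlam)
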